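/- **Conventions.** Work in the category $\mathbf{sSet}$ of simplicial sets. A map is a \emph{left fibration} (resp. \emph{right fibration}) if it has the right lifting property with respect to all horn inclusions $\Lambda^n_k\to\Delta^n$ with $0\le k<n$ (resp. $0<k\le n$). Consider the cylinder $K\mapsto \Delta^1\times K$ with its two endpoint inclusions and its projection. Let $\Lambda^r$ be the smallest set of maps that contains $$\Delta^1\times\partial\Delta^n\,\cup\,\{1\}\times\Delta^n\to\Delta^1\times\Delta^n\qquad(n\ge 0)$$ and contains, with every $i\colon K\to L$, the map $$\partial\Delta^1\times L\sqcup_{\partial\Delta^1\times K}\Delta^1\times K\to\Delta^1\times L .$$ The \emph{right anodyne extensions} of the datum $(\Delta^1,\varnothing)$ are the maps with the left lifting property against all maps that have the right lifting property against $\Lambda^r$; the \emph{right $(\Delta^1,\varnothing)$-fibrations} are the maps with the right lifting property against the right anodyne extensions. Left anodyne extensions and left $(\Delta^1,\varnothing)$-fibrations are defined in the same way with $\{0\}$ in place of $\{1\}$. For a simplicial set $A$ and objects $X,W$ of $\mathbf{sSet}/A$, let $[X,W]_A$ be the quotient of $\operatorname{Hom}_{\mathbf{sSet}/A}(X,W)$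 by the equivalence relation generated by homotopies $\Delta^1\times X\to W$ over $A$. A map $f\colon X\to Y$ over $A$ is a \emph{contravariant} (resp. \emph{covariant}) \emph{equivalence} over $A$ if $f^*\colon[Y,W]_A\to[X,W]_A$ is bijective for every $W\to A$ that is a right (resp. left) $(\Delta^1,\varnothing)$-fibration; these are the weak equivalences of the contravariant (resp. covariant) model structure on $\mathbf{sSet}/A$ generated by $(\Delta^1,\varnothing)$. A map $f\colon X\to Y$ is \emph{final} (resp. \emph{initial}) if, for every simplicial set $A$ and every map $Y\to A$, it is a contravariant (resp. covariant) equivalence over $A$. A map $p\colon X\to Y$ is \emph{proper} (resp. \emph{smooth}) if for every diagram $$\begin{array}{ccccc}A'&\xrightarrow{\,w\,}&B'&\to&X\\ \downarrow&&\downarrow&&\downarrow{\scriptstyle p}\\ A&\xrightarrow{\,v\,}&B&\to&Y\end{array}$$ in which both squares are cartesian, $w$ is final (resp. initial) whenever $v$ is final (resp. initial). **Proposition.** Every left fibration of simplicial sets is proper, and every right fibration of simplicial sets is smooth. -/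

import Mathlib

open CategoryTheory Limits MonoidalCategory CartesianMonoidalCategory

universe u

noncomputable section

namespace SimplicialFinality

section

open Simplicial

/-! ### Left and right fibrations of simplicial sets -/

/-- The left horn inclusions `Λⁿₖ ⟶ Δⁿ`, `0 ≤ k < n` (written with `n = m + 1`). -/
inductive leftHornInclusions : MorphismProperty SSet.{u} where
  | intro {m : ℕ} (k : Fin (m + 2)) (hk : k < Fin.last (m + 1)) :
      leftHornInclusions Λ[m + 1, k].ι

/-- The right horn inclusions `Λⁿₖ ⟶ Δⁿ`, `0 < k ≤ n` (written with `n = m + 1`). -/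
inductive rightHornInclusions : MorphismProperty SSet.{u} where
  | intro {m : ℕ} (k : Fin (m + 2)) (hk : 0 < k) :
      rightHornInclusions Λ[m + 1, k].ι

/-- Left fibrations of simplicial sets. -/
def leftFibrations : MorphismProperty SSet.{u} := leftHornInclusions.rlp

/-- Right fibrations of simplicial sets. -/
def rightFibrations : MorphismProperty SSet.{u} := rightHornInclusions.rlp

/-! ### The elementary homotopical datum `(Δ¹, ∅)`

The cylinder is the functor `K ↦ K ⊗ Δ[1]` (cartesian product) with the two endpoint inclusions
`SSet.ι₀, SSet.ι₁ : K ⟶ K ⊗ Δ[1]` and the projection `fst K Δ[1]`. -/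

/-- For a map `i : K ⟶ L`, the map `L × {e} ⊔_{K × {e}} K × Δ¹ ⟶ L × Δ¹`: the pushout-product
of `i` with the inclusion of the vertex `e` in `Δ[1]`. -/
def vertexPushoutProduct (e : Fin 2) {K L : SSet.{u}} (i : K ⟶ L) :
    pushout (i ▷ (SSet.stdSimplex.face.{u} (n := 1) {e} : SSet.{u}))
      (K ◁ (SSet.stdSimplex.face.{u} (n := 1) {e}).ι) ⟶ L ⊗ Δ[1] :=
  pushout.desc (L ◁ (SSet.stdSimplex.face.{u} (n := 1) {e}).ι) (i ▷ Δ[1])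
    (whisker_exchange _ _).symm

/-- For a map `i : K ⟶ L`, the map `L × ∂Δ¹ ⊔_{K × ∂Δ¹} K × Δ¹ ⟶ L × Δ¹`: the pushout-product
of `i` with the inclusion of `∂Δ[1]` in `Δ[1]`. -/
def boundaryPushoutProduct {K L : SSet.{u}} (i : K ⟶ L) :
    pushout (i ▷ (∂Δ[1] : SSet.{u})) (K ◁ ∂Δ[1].ι) ⟶ L ⊗ Δ[1] :=
  pushout.desc (L ◁ ∂Δ[1].ι) (i ▷ Δ[1]) (whisker_exchange _ _).symm

end

/-- The generators of the right (`e = 1`) and left (`e = 0`) anodyne extensions associated with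
the datum `(Δ¹, ∅)`: start with the pushout-products of the boundary inclusions
`∂Δ[n] ⟶ Δ[n]` (which generate the monomorphisms) with the vertex `{e} ⟶ Δ[1]`, and
iterate the pushout-product with `∂Δ[1] ⟶ Δ[1]`. -/
inductive anodyneGenerators (e : Fin 2) : MorphismProperty SSet.{u} where
  | vertex (n : ℕ) :
      anodyneGenerators e (vertexPushoutProduct e (SSet.boundary n).ι)
  | boundary {K L : SSet.{u}} (i : K ⟶ L) (hi : anodyneGenerators e i) :
      anodyneGenerators e (boundaryPushoutProduct i)

/-- The right (`e = 1`) and left (`e = 0`) anodyne extensions associated with the datum `(Δ¹, ∅)`: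
the saturated class generated by `anodyneGenerators e`. -/
def cylinderAnodyne (e : Fin 2) : MorphismProperty SSet.{u} := (anodyneGenerators e).rlp.llp

/-- The right (`e = 1`) and left (`e = 0`) fibrations associated with the datum `(Δ¹, ∅)`. -/
def cylinderFibrations (e : Fin 2) : MorphismProperty SSet.{u} := (cylinderAnodyne e).rlp

/-! ### Contravariant and covariant equivalences over a simplicial set -/

section Slice

open Simplicial

variable {A : SSet.{u}}

/-- There is a homotopy from `f` to `g` over `A`, i.e. a map `h : X × Δ¹ ⟶ W` over `A`
(where `X × Δ¹` lies over `A` via the projection to `X`) which restricts to `f` at the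
vertex `0` and to `g` at the vertex `1`. -/
def SliceHomotopic {X W : Over A} (f g : X ⟶ W) : Prop :=
  ∃ h : X.left ⊗ Δ[1] ⟶ W.left,
    h ≫ W.hom = fst X.left Δ[1] ≫ X.hom ∧ SSet.ι₀ ≫ h = f.left ∧ SSet.ι₁ ≫ h = g.left

/-- Homotopy classes of maps over `A`: the quotient of `X ⟶ W` by the equivalence relation
generated by the homotopies over `A`. -/
def SliceHomotopyClasses (X W : Over A) : Type u :=
  Quot (SliceHomotopic (X := X) (W := W))

lemma SliceHomotopic.precomp {X Y W : Over A} (f : X ⟶ Y) {g g' : Y ⟶ W}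
    (H : SliceHomotopic g g') : SliceHomotopic (f ≫ g) (f ≫ g') := by
  obtain ⟨h, hw, h₀, h₁⟩ := H
  refine ⟨f.left ▷ Δ[1] ≫ h, ?_, ?_, ?_⟩
  · rw [Category.assoc, hw, whiskerRight_fst_assoc, Over.w f]
  · rw [SSet.ι₀_comp_assoc, h₀, Over.comp_left]
  · rw [SSet.ι₁_comp_assoc, h₁, Over.comp_left]

/-- The map `f^* : [Y, W] → [X, W]` induced by `f : X ⟶ Y`. -/
def SliceHomotopyClasses.precomp {X Y : Over A} (f : X ⟶ Y) (W : Over A) :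
    SliceHomotopyClasses Y W → SliceHomotopyClasses X W :=
  Quot.map (fun g => f ≫ g) (fun _ _ H => H.precomp f)

/-- The weak equivalences of the contravariant (`e = 1`) and of the covariant (`e = 0`) model
structure over `A` generated by `(Δ¹, ∅)`: the maps `f : X ⟶ Y` over `A` such that
`f^* : [Y, W] → [X, W]` is bijective for every fibrant object `W` over `A`, i.e. for every `W`
whose structure map to `A` is a right (resp. left) fibration for the datum. -/
def IsSliceEquivalence (e : Fin 2) {X Y : Over A} (f : X ⟶ Y) : Prop :=
  ∀ W : Over A, cylinderFibrations e W.hom →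
    Function.Bijective (SliceHomotopyClasses.precomp f W)

/-- Equivalences of the contravariant model structure over `A`. -/
def IsContravariantEquivalence {X Y : Over A} (f : X ⟶ Y) : Prop := IsSliceEquivalence 1 f

/-- Equivalences of the covariant model structure over `A`. -/
def IsCovariantEquivalence {X Y : Over A} (f : X ⟶ Y) : Prop := IsSliceEquivalence 0 f

end Slice

/-! ### Final and initial maps, proper and smooth maps -/

/-- A map `f : X ⟶ Y` is final if it is a contravariant equivalence over every `A`, for every
map `Y ⟶ A`. -/
def IsFinal {X Y : SSet.{u}} (f : X ⟶ Y) : Prop :=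
  ∀ (A : SSet.{u}) (p : Y ⟶ A),
    IsContravariantEquivalence (Over.homMk f : Over.mk (f ≫ p) ⟶ Over.mk p)

/-- A map `f : X ⟶ Y` is initial if it is a covariant equivalence over every `A`, for every
map `Y ⟶ A`. -/
def IsInitialMap {X Y : SSet.{u}} (f : X ⟶ Y) : Prop :=
  ∀ (A : SSet.{u}) (p : Y ⟶ A),
    IsCovariantEquivalence (Over.homMk f : Over.mk (f ≫ p) ⟶ Over.mk p)

/-- A map `p : X ⟶ Y` is proper if, for all cartesian squares
```
  A' --w--> B' --s--> X
  |         |         |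
  a         b         p
  v         v         v
  A  --v--> B  --t--> Y
```
the map `w` is final whenever `v` is final. -/
def IsProperMap {X Y : SSet.{u}} (p : X ⟶ Y) : Prop :=
  ∀ ⦃A' B' A B : SSet.{u}⦄ (w : A' ⟶ B') (s : B' ⟶ X) (a : A' ⟶ A) (b : B' ⟶ B)
    (v : A ⟶ B) (t : B ⟶ Y),
    IsPullback w a b v → IsPullback s b p t → IsFinal v → IsFinal w

/-- A map `p : X ⟶ Y` is smooth if, for all cartesian squares
```
  A' --w--> B' --s--> X
  |         |         |
  a         b         p
  v         v         v
  A  --v--> B  --t--> Y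
```
the map `w` is initial whenever `v` is initial. -/
def IsSmoothMap {X Y : SSet.{u}} (p : X ⟶ Y) : Prop :=
  ∀ ⦃A' B' A B : SSet.{u}⦄ (w : A' ⟶ B') (s : B' ⟶ X) (a : A' ⟶ A) (b : B' ⟶ B)
    (v : A ⟶ B) (t : B ⟶ Y),
    IsPullback w a b v → IsPullback s b p t → IsInitialMap v → IsInitialMap w

end SimplicialFinality

end

/-! Both halves are one statement about an endpoint `e` of Δ¹: pullback along a fibration for the
opposite endpoint `e.rev` preserves `e`-finality (`IsEndpointFinal.of_isPullback`; `e = 1` is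
properness, `e = 0` smoothness). Left and right fibrations are fibrations for the endpoints 0 and 1
because horn-by-boundary pushout-products are anodyne (`leftFibrations_le`, `rightFibrations_le`).

Factor an `e`-final map as an `e`-anodyne map followed by an `e`-fibration. The second factor is
again `e`-final, and an `e`-final `e`-fibration is a trivial fibration
(`IsEndpointFinal.trivialFibrations`). Trivial fibrations are stable under pullback and `e`-final,
so it remains to pull back anodyne maps.

For A × Δ¹ ∪ L × {e} → L × Δ¹ this is a deformation argument: the contraction of Δ¹ onto `e` lifts
through an `e.rev`-fibration (`cylinderAnodyne_of_isPullback_unionProd`). The general case follows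
by adjunction: the dependent product along an `e.rev`-fibration p preserves `e`-fibrations
(`cylinderFibrations_piObj_π`), hence pullback along p preserves `e`-anodyne maps
(`cylinderAnodyne_of_isPullback`). -/

namespace SimplicialFinality

open Simplicial

/-! ### Products of horns with boundaries, and duality. -/

/-- The preimage of a subcomplex under an isomorphism has an isomorphic inclusion. -/
noncomputable def arrowIsoOfPreimage {X Y : SSet.{u}} (e : Y ≅ X) (A : X.Subcomplex) :
    Arrow.mk (A.preimage e.hom).ι ≅ Arrow.mk A.ι :=
  Arrow.isoMk
    { hom := SSet.Subcomplex.lift ((A.preimage e.hom).ι ≫ e.hom) (by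
        rintro n _ ⟨⟨x, hx⟩, rfl⟩
        exact hx)
      inv := SSet.Subcomplex.lift (A.ι ≫ e.inv) (by
        rintro n _ ⟨⟨x, hx⟩, rfl⟩
        change e.hom.app n (e.inv.app n x) ∈ A.obj n
        have := ConcreteCategory.congr_hom (NatTrans.congr_app e.inv_hom_id n) x
        erw [this]
        exact hx)
      hom_inv_id := by
        rw [← cancel_mono (A.preimage e.hom).ι]
        change (A.preimage e.hom).ι ≫ e.hom ≫ e.inv = (A.preimage e.hom).ι
        simp
      inv_hom_id := by
        rw [← cancel_mono A.ι]
        change A.ι ≫ e.inv ≫ e.hom = A.ι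
        simp } e rfl

/-- A regular pairing exhibits X as built from A by attaching horns, each at the index of its paired
face; when no index is last, only left horns occur. -/
lemma leftHornInclusions_rlp_llp_of_pairing {X : SSet.{u}} {A : X.Subcomplex} (P : A.Pairing)
    [P.IsRegular]
    (hP : ∀ (x : P.II), (P.isUniquelyCodimOneFace x).index rfl ≠ Fin.last _) :
    leftHornInclusions.rlp.llp A.ι :=
  MorphismProperty.transfiniteCompositionsOfShape_le _ _ _
    ⟨P.rankFunction.relativeCellComplex.toTransfiniteCompositionOfShape, fun j hj ↦ by
      refine (?_ : (_ : MorphismProperty _) ≤ _ ) _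
        (P.rankFunction.relativeCellComplex.attachCells j hj).pushouts_coproducts
      simp only [MorphismProperty.pushouts_le_iff, MorphismProperty.coproducts_le_iff]
      rintro _ _ _ ⟨c⟩
      exact MorphismProperty.le_llp_rlp _ _
        (leftHornInclusions.intro _ (Fin.lt_last_iff_ne_last.2 (hP c.s)))⟩

lemma pairing_index_ne_last {X : SSet.{u}} {A : X.Subcomplex} (h : A.PairingCore) [h.IsProper]
    (hP : ∀ s, h.index s ≠ Fin.last _) (x : h.pairing.II) :
    (h.pairing.isUniquelyCodimOneFace x).index rfl ≠ Fin.last _ := by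
  obtain ⟨s, rfl⟩ := h.equivII.surjective x
  -- The face `y` is generalized so that its equality with `h.type₁ s`, on which the type of the
  -- index depends, can be eliminated.
  have key : ∀ (y : X.S) (hy : y = (h.type₁ s).toS)
      (hxy : SSet.S.IsUniquelyCodimOneFace (h.type₂ s).toS y),
      (hxy.index rfl : Fin _) ≠ Fin.last _ := by
    rintro _ rfl hxy
    have := h.isUniquelyCodimOneFace_index s
    intro h'
    exact hP s (this.symm.trans h')
  exact key _ (congr_arg (fun y : A.N ↦ y.toS) (h.type₁_pairing s).symm) _

lemma leftHornInclusions_rlp_llp_unionProd {m : ℕ} (k : Fin (m + 1)) (n : ℕ) :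
    leftHornInclusions.rlp.llp (SSet.Subcomplex.unionProd.{u} Λ[m + 1, k.castSucc] ∂Δ[n]).ι := by
  refine leftHornInclusions_rlp_llp_of_pairing
    (SSet.prodStdSimplex.pairingCore.{u} k n).pairing ?_
  exact pairing_index_ne_last _ (fun s ↦ (Fin.castSucc_lt_last _).ne)

/-- The involution `SSet.opFunctor` sends the inclusion of `A` to the inclusion of `A.op`. -/
noncomputable def opFunctorMapSubcomplexι {X : SSet.{u}} (A : X.Subcomplex) :
    Arrow.mk (SSet.opFunctor.map A.ι) ≅ Arrow.mk A.op.ι :=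
  Arrow.isoMk (NatIso.ofComponents (fun _ ↦ Iso.refl _) (fun _ ↦ rfl)) (Iso.refl _) rfl

instance : SSet.opFunctor.{u}.IsEquivalence :=
  inferInstanceAs SSet.opEquivalence.{u}.functor.IsEquivalence

lemma hasLiftingProperty_opFunctor_iff {X Y E B : SSet.{u}} (e : Y ≅ X.op) {A : X.Subcomplex}
    {A' : Y.Subcomplex} (hA : A.op.preimage e.hom = A') (p : E ⟶ B) :
    HasLiftingProperty A'.ι (SSet.opFunctor.map p) ↔ HasLiftingProperty A.ι p := by
  subst hA
  rw [← Functor.hasLiftingProperty_iff_of_isEquivalence SSet.opFunctor A.ι p]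
  exact HasLiftingProperty.iff_of_arrow_iso_left
    (arrowIsoOfPreimage e A.op ≪≫ (opFunctorMapSubcomplexι A).symm) _

lemma leftHornInclusions_rlp_opFunctor_map {E B : SSet.{u}} (p : E ⟶ B)
    (hp : rightHornInclusions.rlp p) : leftHornInclusions.rlp (SSet.opFunctor.map p) := by
  rintro _ _ _ ⟨k, hk⟩
  have h := hp _ (rightHornInclusions.intro k.rev (by
    rwa [Fin.pos_iff_ne_zero, ne_eq, Fin.rev_eq_iff, Fin.rev_zero, ← ne_eq,
      ← Fin.lt_last_iff_ne_last]))
  rwa [hasLiftingProperty_opFunctor_iff (SSet.stdSimplex.opIso _).symm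
    (A := SSet.horn _ k.rev) (by simp [SSet.op_horn])]

/-- Dual to the case `k = 0` of the left horns: passing to opposites reverses the vertices and
exchanges the two kinds of fibrations. -/
lemma rightHornInclusions_rlp_llp_unionProd (m n : ℕ) :
    rightHornInclusions.rlp.llp
      (SSet.Subcomplex.unionProd.{u} Λ[m + 1, Fin.last (m + 1)] ∂Δ[n]).ι := by
  intro X Y p hp
  have := leftHornInclusions_rlp_llp_unionProd (0 : Fin (m + 1)) n _
    (leftHornInclusions_rlp_opFunctor_map p hp)
  rwa [hasLiftingProperty_opFunctor_iff
    (((SSet.stdSimplex.opIso _).symm ⊗ᵢ (SSet.stdSimplex.opIso _).symm) ≪≫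
        Functor.Monoidal.μIso SSet.opFunctor _ _)
    (A := SSet.Subcomplex.unionProd.{u} Λ[m + 1, Fin.last (m + 1)] ∂Δ[n]) (by
      have h₁ := SSet.op_boundary.{u} n
      have h₂ := SSet.op_horn.{u} (Fin.last (m + 1))
      rw [Fin.rev_last] at h₂
      exact congr_arg₂ SSet.Subcomplex.unionProd h₂ h₁)] at this

/-! ### Comparison with the fibrations of the cylinder. -/

/-- The endpoint `e` of `Δ[1]`, as a subcomplex. -/
abbrev vertexSubcomplex (e : Fin 2) : (Δ[1] : SSet.{u}).Subcomplex :=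
  SSet.stdSimplex.face.{u} (n := 1) {e}

lemma horn_one_eq (e : Fin 2) : Λ[1, e] = vertexSubcomplex.{u} e := by
  rw [SSet.horn_eq_iSup]
  fin_cases e
  · refine le_antisymm (iSup_le ?_) (le_iSup_of_le ⟨1, by simp⟩ ?_)
    · rintro ⟨i, hi⟩
      fin_cases i
      · simp at hi
      · simp [SSet.stdSimplex.face_le_face_iff]; decide
    · simp [SSet.stdSimplex.face_le_face_iff]
  · refine le_antisymm (iSup_le ?_) (le_iSup_of_le ⟨0, by simp⟩ ?_)
    · rintro ⟨i, hi⟩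
      fin_cases i
      · simp [SSet.stdSimplex.face_le_face_iff]; decide
      · simp at hi
    · simp [SSet.stdSimplex.face_le_face_iff]

section

open MonoidalCategory.Arrow

lemma hasLiftingProperty_unionProd_iff_swap {X Y E B : SSet.{u}} (S : X.Subcomplex)
    (T : Y.Subcomplex) (p : E ⟶ B) :
    HasLiftingProperty (S.unionProd T).ι p ↔ HasLiftingProperty (T.unionProd S).ι p :=
  HasLiftingProperty.iff_of_arrow_iso_left
    (Arrow.isoMk (SSet.Subcomplex.unionProd.symmIso S T) (β_ _ _) rfl) p

/-- By adjunction, lifting against S × Y ∪ X × T is lifting against S → X for the pullback-hom of T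
→ Y and p. A map lifting against boundary inclusions lifts against all monomorphisms. -/
lemma hasLiftingProperty_unionProd_of_boundary {Y E B : SSet.{u}} (T : Y.Subcomplex) (p : E ⟶ B)
    (hp : ∀ n, HasLiftingProperty (SSet.Subcomplex.unionProd (SSet.boundary.{u} n) T).ι p)
    {X : SSet.{u}} (S : X.Subcomplex) : HasLiftingProperty (S.unionProd T).ι p := by
  have key {X : SSet.{u}} (S : X.Subcomplex) : HasLiftingProperty (S.unionProd T).ι p ↔
      HasLiftingProperty S.ι
        (Functor.PullbackObjObj.ofHasPullback MonoidalClosed.internalHom T.ι p).π := by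
    rw [hasLiftingProperty_unionProd_iff_swap]
    exact MonoidalClosed.internalHomAdjunction₂.hasLiftingProperty_iff
      (SSet.Subcomplex.unionProd.pushoutObjObj T S)
      (Functor.PullbackObjObj.ofHasPullback MonoidalClosed.internalHom T.ι p)
  rw [key]
  suffices (MorphismProperty.monomorphisms _).rlp
      (Functor.PullbackObjObj.ofHasPullback MonoidalClosed.internalHom T.ι p).π from
    this _ inferInstance
  rw [SSet.rlp_monomorphisms]
  rintro _ _ _ ⟨n⟩
  exact (key _).1 (hp n)

/-- Exchange of the last two factors. -/
noncomputable def tensorSwap (X Y Z : SSet.{u}) : (X ⊗ Y) ⊗ Z ≅ (X ⊗ Z) ⊗ Y where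
  hom := lift (lift (fst _ _ ≫ fst _ _) (snd _ _)) (fst _ _ ≫ snd _ _)
  inv := lift (lift (fst _ _ ≫ fst _ _) (snd _ _)) (fst _ _ ≫ snd _ _)

lemma preimage_tensorSwap {X Y Z : SSet.{u}} (A : X.Subcomplex) (B : Y.Subcomplex)
    (C : Z.Subcomplex) :
    ((A.unionProd C).unionProd B).preimage (tensorSwap X Y Z).hom =
      (A.unionProd B).unionProd C := by
  ext n ⟨⟨x, y⟩, z⟩
  change (⟨⟨x, z⟩, y⟩ : ((X ⊗ Z) ⊗ Y).obj n) ∈ ((A.unionProd C).unionProd B).obj n ↔ _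
  have h₁ := SSet.Subcomplex.mem_unionProd_iff (A.unionProd C) B (n := n) ⟨⟨x, z⟩, y⟩
  have h₂ := SSet.Subcomplex.mem_unionProd_iff A C (n := n) ⟨x, z⟩
  have h₃ := SSet.Subcomplex.mem_unionProd_iff (A.unionProd B) C (n := n) ⟨⟨x, y⟩, z⟩
  have h₄ := SSet.Subcomplex.mem_unionProd_iff A B (n := n) ⟨x, y⟩
  refine h₁.trans (Iff.trans ?_ h₃.symm)
  refine (or_congr Iff.rfl h₂).trans (Iff.trans ?_ (or_congr Iff.rfl h₄).symm)
  tauto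

/-- Pushout-products commute, so a pushout-product with ∂Δ¹ can be absorbed into the subcomplex A;
iterating it leaves the same class of inclusions. -/
lemma anodyneGenerators_exists_iso {e : Fin 2} {K L : SSet.{u}} {i : K ⟶ L}
    (hi : anodyneGenerators e i) : ∃ (X : SSet.{u}) (A : X.Subcomplex),
      Nonempty (Arrow.mk i ≅ Arrow.mk (A.unionProd (vertexSubcomplex e)).ι) := by
  induction hi with
  | vertex n => exact ⟨_, SSet.boundary n, ⟨(SSet.Subcomplex.unionProd.ιIso _ _).symm⟩⟩
  | boundary i hi h =>
    obtain ⟨X, A, ⟨f⟩⟩ := h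
    refine ⟨_, A.unionProd ∂Δ[1], ⟨?_⟩⟩
    refine (pushoutProduct.mapIso f).app (Arrow.mk (∂Δ[1] : SSet.Subcomplex.{u} _).ι) ≪≫
      (SSet.Subcomplex.unionProd.ιIso _ _).symm ≪≫ eqToIso ?_ ≪≫
      arrowIsoOfPreimage (tensorSwap X Δ[1] Δ[1]) _
    rw [preimage_tensorSwap]

lemma anodyneGenerators_rlp_iff (e : Fin 2) {E B : SSet.{u}} (p : E ⟶ B) :
    (anodyneGenerators e).rlp p ↔ ∀ ⦃L : SSet.{u}⦄ (A : L.Subcomplex),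
      HasLiftingProperty (A.unionProd (vertexSubcomplex e)).ι p := by
  refine ⟨fun hp L A ↦ hasLiftingProperty_unionProd_of_boundary _ _ (fun n ↦ ?_) A,
    fun hp _ _ i hi ↦ ?_⟩
  · rw [HasLiftingProperty.iff_of_arrow_iso_left (SSet.Subcomplex.unionProd.ιIso _ _)]
    exact hp _ (.vertex n)
  · obtain ⟨X, A, ⟨f⟩⟩ := anodyneGenerators_exists_iso hi
    rw [HasLiftingProperty.iff_of_arrow_iso_left f]
    exact hp A

lemma cylinderFibrations_eq (e : Fin 2) :
    cylinderFibrations.{u} e = (anodyneGenerators e).rlp := by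
  rw [cylinderFibrations, cylinderAnodyne, MorphismProperty.rlp_llp_rlp]

lemma cylinderFibrations_iff (e : Fin 2) {E B : SSet.{u}} (p : E ⟶ B) :
    cylinderFibrations e p ↔ ∀ ⦃L : SSet.{u}⦄ (A : L.Subcomplex),
      HasLiftingProperty (A.unionProd (vertexSubcomplex e)).ι p := by
  rw [cylinderFibrations_eq, anodyneGenerators_rlp_iff]

lemma cylinderAnodyne_iff (e : Fin 2) {K L : SSet.{u}} (i : K ⟶ L) :
    cylinderAnodyne e i ↔ ∀ ⦃E B : SSet.{u}⦄ (p : E ⟶ B), cylinderFibrations e p →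
      HasLiftingProperty i p := by
  rw [cylinderFibrations_eq]
  rfl

lemma leftFibrations_le {E B : SSet.{u}} {p : E ⟶ B} (hp : leftFibrations p) :
    cylinderFibrations 0 p := by
  rw [cylinderFibrations_iff]
  refine fun L A ↦ hasLiftingProperty_unionProd_of_boundary _ _ (fun n ↦ ?_) A
  rw [hasLiftingProperty_unionProd_iff_swap, ← horn_one_eq]
  exact leftHornInclusions_rlp_llp_unionProd (0 : Fin 1) n _ hp

lemma rightFibrations_le {E B : SSet.{u}} {p : E ⟶ B} (hp : rightFibrations p) :
    cylinderFibrations 1 p := by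
  rw [cylinderFibrations_iff]
  refine fun L A ↦ hasLiftingProperty_unionProd_of_boundary _ _ (fun n ↦ ?_) A
  rw [hasLiftingProperty_unionProd_iff_swap, ← horn_one_eq]
  exact rightHornInclusions_rlp_llp_unionProd 0 n _ hp

/-- The generators are closed under this operation by construction, and the adjunction with the
pullback-hom extends closure to the saturated class. -/
lemma cylinderAnodyne_boundaryPushoutProduct {e : Fin 2} {K L : SSet.{u}} {i : K ⟶ L}
    (hi : cylinderAnodyne e i) : cylinderAnodyne e (boundaryPushoutProduct i) := by
  intro E B p hp
  let q := (Functor.PullbackObjObj.ofHasPullback MonoidalClosed.internalHom ∂Δ[1].ι p).π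
  have key {K L : SSet.{u}} (i : K ⟶ L) :
      HasLiftingProperty (boundaryPushoutProduct i) p ↔ HasLiftingProperty i q :=
    PushoutProduct.hasLiftingProperty_mk_iff'
  rw [key]
  refine hi _ (fun _ _ j hj ↦ ?_)
  rw [← key]
  exact hp _ (.boundary j hj)

lemma cylinderAnodyne_vertexPushoutProduct (e : Fin 2) {K L : SSet.{u}} (i : K ⟶ L) [Mono i] :
    cylinderAnodyne e (vertexPushoutProduct e i) := by
  rw [cylinderAnodyne_iff]
  intro E B p hp
  let f : Arrow.mk i ≅ Arrow.mk (SSet.Subcomplex.range i).ι :=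
    Arrow.isoMk (asIso (SSet.Subcomplex.toRange i)) (Iso.refl _) rfl
  refine (HasLiftingProperty.iff_of_arrow_iso_left ((pushoutProduct.mapIso f).app
    (Arrow.mk (vertexSubcomplex.{u} e).ι) ≪≫ (SSet.Subcomplex.unionProd.ιIso _ _).symm) p).2 ?_
  exact (cylinderFibrations_iff e p).1 hp _

/-! ### Endpoint inclusions and homotopy lifting. -/

/-- The inclusion `X ⟶ X ⊗ Δ[1]` of the endpoint `e`. -/
noncomputable def endpoint (e : Fin 2) (X : SSet.{u}) : X ⟶ X ⊗ Δ[1] :=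
  lift (𝟙 X) (SSet.const (SSet.stdSimplex.obj₀Equiv.{u}.symm e))

lemma endpoint_zero (X : SSet.{u}) : endpoint 0 X = SSet.ι₀ := rfl

lemma endpoint_one (X : SSet.{u}) : endpoint 1 X = SSet.ι₁ := rfl

lemma endpoint_fst (e : Fin 2) (X : SSet.{u}) : endpoint e X ≫ fst X Δ[1] = 𝟙 X := rfl

lemma endpoint_naturality (e : Fin 2) {X Y : SSet.{u}} (f : X ⟶ Y) :
    endpoint e X ≫ f ▷ Δ[1] = f ≫ endpoint e Y := rfl

/-- An endpoint inclusion factors through the product with a vertex. -/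
noncomputable def endpointLift (e : Fin 2) (X : SSet.{u}) :
    X ⟶ X ⊗ (vertexSubcomplex.{u} e : SSet.{u}) :=
  lift (𝟙 X) (SSet.Subcomplex.lift (SSet.const (SSet.stdSimplex.obj₀Equiv.{u}.symm e)) (by
    rintro ⟨⟨n⟩⟩ _ ⟨x, rfl⟩
    rw [SSet.stdSimplex.mem_face_iff]
    intro i
    rw [Finset.mem_singleton]
    rfl))

lemma endpointLift_comp (e : Fin 2) (X : SSet.{u}) :
    endpointLift e X ≫ X ◁ (vertexSubcomplex.{u} e).ι = endpoint e X := rfl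

lemma endpointLift_fst (e : Fin 2) (X : SSet.{u}) :
    endpointLift e X ≫ fst _ _ = 𝟙 X := rfl

/-- The constant simplex of `Δ[1]` at the vertex `e`. -/
noncomputable def constSimplex (e : Fin 2) (n : SimplexCategoryᵒᵖ) : (Δ[1] : SSet.{u}).obj n :=
  (Δ[1] : SSet.{u}).map (n.unop.const _ 0).op (SSet.stdSimplex.obj₀Equiv.{u}.symm e)

lemma constSimplex_map (e : Fin 2) {n m : SimplexCategoryᵒᵖ} (f : n ⟶ m) :
    (Δ[1] : SSet.{u}).map f (constSimplex e n) = constSimplex e m := by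
  have := NatTrans.naturality_apply
    (SSet.const (X := (Δ[1] : SSet.{u})) (SSet.stdSimplex.obj₀Equiv.{u}.symm e)) f
    (constSimplex e n)
  exact this.symm

lemma mem_vertexSubcomplex_iff {e : Fin 2} {n : SimplexCategoryᵒᵖ}
    (t : (Δ[1] : SSet.{u}).obj n) :
    t ∈ (vertexSubcomplex.{u} e).obj n ↔ t = constSimplex e n := by
  obtain ⟨n⟩ := n
  induction n using SimplexCategory.rec with | _ n
  rw [SSet.stdSimplex.mem_face_iff]
  simp only [Finset.mem_singleton]
  constructor
  · intro h
    ext i : 1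
    exact h i
  · rintro rfl i
    rfl

lemma mem_boundary_one_iff {n : SimplexCategoryᵒᵖ} (t : (Δ[1] : SSet.{u}).obj n) :
    t ∈ (SSet.boundary.{u} 1).obj n ↔ ∃ e, t = constSimplex e n := by
  have h : SSet.boundary.{u} 1 = ⨆ e, vertexSubcomplex.{u} e := by
    rw [SSet.boundary_eq_iSup]
    -- In Δ¹ the face opposite to the vertex `i` is the vertex `i.rev`.
    refine le_antisymm (iSup_le fun i ↦ le_iSup_of_le i.rev ?_)
      (iSup_le fun i ↦ le_iSup_of_le i.rev ?_) <;>
    · rw [SSet.stdSimplex.face_le_face_iff]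
      fin_cases i <;> decide
  rw [h]
  simp [mem_vertexSubcomplex_iff]

lemma constSimplex_injective (n : SimplexCategoryᵒᵖ) :
    Function.Injective (fun e ↦ constSimplex.{u} e n) := by
  obtain ⟨n⟩ := n
  induction n using SimplexCategory.rec with | _ n
  intro e e' h
  exact DFunLike.congr_fun (F := Δ[1] _⦋n⦌) h (0 : Fin (n + 1))

lemma whiskerLeft_vertexSubcomplex_ι (e : Fin 2) (X : SSet.{u}) :
    X ◁ (vertexSubcomplex.{u} e).ι = fst _ _ ≫ endpoint e X := by
  apply NatTrans.ext
  funext n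
  ext ⟨x, t, ht⟩
  exact Prod.ext rfl ((mem_vertexSubcomplex_iff t).1 ht)

lemma inl_vertexPushoutProduct (e : Fin 2) {K L : SSet.{u}} (i : K ⟶ L) :
    pushout.inl _ _ ≫ vertexPushoutProduct e i = L ◁ (vertexSubcomplex.{u} e).ι :=
  pushout.inl_desc _ _ _

lemma inr_vertexPushoutProduct (e : Fin 2) {K L : SSet.{u}} (i : K ⟶ L) :
    pushout.inr _ _ ≫ vertexPushoutProduct e i = i ▷ Δ[1] :=
  pushout.inr_desc _ _ _

lemma inl_boundaryPushoutProduct {K L : SSet.{u}} (i : K ⟶ L) :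
    pushout.inl _ _ ≫ boundaryPushoutProduct i = L ◁ (SSet.boundary.{u} 1).ι :=
  pushout.inl_desc _ _ _

lemma inr_boundaryPushoutProduct {K L : SSet.{u}} (i : K ⟶ L) :
    pushout.inr _ _ ≫ boundaryPushoutProduct i = i ▷ Δ[1] :=
  pushout.inr_desc _ _ _

/-- Homotopy lifting, for a cylinder fibration, with a prescribed endpoint. -/
lemma exists_lift_of_endpoint {e : Fin 2} {E B : SSet.{u}} {p : E ⟶ B}
    (hp : cylinderFibrations e p) {K L : SSet.{u}} (i : K ⟶ L) [Mono i] (a : L ⟶ E)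
    (h : K ⊗ Δ[1] ⟶ E) (b : L ⊗ Δ[1] ⟶ B) (h₁ : endpoint e K ≫ h = i ≫ a)
    (h₂ : a ≫ p = endpoint e L ≫ b) (h₃ : h ≫ p = i ▷ Δ[1] ≫ b) :
    ∃ H : L ⊗ Δ[1] ⟶ E, endpoint e L ≫ H = a ∧ i ▷ Δ[1] ≫ H = h ∧ H ≫ p = b := by
  have := hp _ (cylinderAnodyne_vertexPushoutProduct e i)
  let t : pushout (i ▷ (vertexSubcomplex.{u} e : SSet.{u}))
      (K ◁ (vertexSubcomplex.{u} e).ι) ⟶ E :=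
    pushout.desc (fst _ _ ≫ a) h (by
      rw [whiskerLeft_vertexSubcomplex_ι, Category.assoc, h₁, whiskerRight_fst_assoc])
  have sq : CommSq t (vertexPushoutProduct e i) p b := ⟨by
    apply pushout.hom_ext
    · rw [reassoc_of% inl_vertexPushoutProduct, pushout.inl_desc_assoc, Category.assoc, h₂,
        whiskerLeft_vertexSubcomplex_ι, Category.assoc]
    · rw [reassoc_of% inr_vertexPushoutProduct, pushout.inr_desc_assoc, h₃]⟩
  refine ⟨sq.lift, ?_, ?_, sq.fac_right⟩
  · have := pushout.inl _ _ ≫= sq.fac_left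
    rw [pushout.inl_desc, reassoc_of% inl_vertexPushoutProduct] at this
    rw [← endpointLift_comp, Category.assoc, this, ← Category.assoc, endpointLift_fst,
      Category.id_comp]
  · have := pushout.inr _ _ ≫= sq.fac_left
    rwa [pushout.inr_desc, reassoc_of% inr_vertexPushoutProduct] at this

/-- The inclusion of an endpoint in `X ⊗ ∂Δ[1]`. -/
noncomputable def boundaryEndpoint (e : Fin 2) (X : SSet.{u}) :
    X ⟶ X ⊗ (SSet.boundary.{u} 1 : SSet.{u}) :=
  lift (𝟙 X) (SSet.Subcomplex.lift (SSet.const (SSet.stdSimplex.obj₀Equiv.{u}.symm e)) (by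
    rintro n _ ⟨x, rfl⟩
    exact (mem_boundary_one_iff _).2 ⟨e, rfl⟩))

lemma boundaryEndpoint_comp (e : Fin 2) (X : SSet.{u}) :
    boundaryEndpoint e X ≫ X ◁ (SSet.boundary.{u} 1).ι = endpoint e X := rfl

lemma boundaryEndpoint_naturality (e : Fin 2) {X Y : SSet.{u}} (f : X ⟶ Y) :
    boundaryEndpoint e X ≫ f ▷ _ = f ≫ boundaryEndpoint e Y := rfl

lemma boundaryEndpoint_hom_ext {X Y : SSet.{u}}
    {f g : X ⊗ (SSet.boundary.{u} 1 : SSet.{u}) ⟶ Y}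
    (h : ∀ e, boundaryEndpoint e X ≫ f = boundaryEndpoint e X ≫ g) : f = g := by
  apply NatTrans.ext
  funext n
  ext ⟨x, t, ht⟩
  obtain ⟨e, rfl⟩ := (mem_boundary_one_iff _).1 ht
  exact ConcreteCategory.congr_hom (NatTrans.congr_app (h e) n) x

/-- The map out of `X ⊗ ∂Δ[1]` given by two maps out of `X`. -/
noncomputable def boundaryDesc {X Y : SSet.{u}} (a : Fin 2 → (X ⟶ Y)) :
    X ⊗ (SSet.boundary.{u} 1 : SSet.{u}) ⟶ Y where
  app n := ↾fun x ↦ (a ((mem_boundary_one_iff _).1 x.2.2).choose).app n x.1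
  naturality n m f := by
    ext ⟨x, t⟩
    have h₁ := ((mem_boundary_one_iff _).1 t.2).choose_spec
    have h₂ := ((mem_boundary_one_iff _).1
      ((SSet.boundary.{u} 1 : SSet.{u}).map f t).2).choose_spec
    -- Naturality requires the vertices chosen before and after restriction to agree; a constant
    -- simplex determines its vertex.
    have h₃ : ((mem_boundary_one_iff _).1
      ((SSet.boundary.{u} 1 : SSet.{u}).map f t).2).choose =
        ((mem_boundary_one_iff _).1 t.2).choose := by
      apply constSimplex_injective m
      dsimp only
      rw [← h₂, ← constSimplex_map _ f, ← h₁]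
      rfl
    refine Eq.trans ?_ (NatTrans.naturality_apply
      (a ((mem_boundary_one_iff _).1 t.2).choose) f x)
    rw [← h₃]
    rfl

lemma boundaryEndpoint_desc {X Y : SSet.{u}} (a : Fin 2 → (X ⟶ Y)) (e : Fin 2) :
    boundaryEndpoint e X ≫ boundaryDesc a = a e := by
  apply NatTrans.ext
  funext n
  ext x
  have ht : constSimplex.{u} e n ∈ (SSet.boundary.{u} 1).obj n :=
    (mem_boundary_one_iff _).2 ⟨e, rfl⟩
  have h : ((mem_boundary_one_iff _).1 ht).choose = e := by
    apply constSimplex_injective n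
    exact ((mem_boundary_one_iff _).1 ht).choose_spec.symm
  refine Eq.trans ?_ (congr_arg (fun e' ↦ (a e').app n x) h)
  rfl

/-- Homotopy lifting along a cylinder anodyne extension, with prescribed endpoints. -/
lemma exists_lift_of_boundary {e : Fin 2} {E B : SSet.{u}} {p : E ⟶ B}
    (hp : cylinderFibrations e p) {K L : SSet.{u}} (i : K ⟶ L) (hi : cylinderAnodyne e i)
    (a : Fin 2 → (L ⟶ E)) (h : K ⊗ Δ[1] ⟶ E) (b : L ⊗ Δ[1] ⟶ B)
    (h₁ : ∀ v, endpoint v K ≫ h = i ≫ a v) (h₂ : ∀ v, a v ≫ p = endpoint v L ≫ b)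
    (h₃ : h ≫ p = i ▷ Δ[1] ≫ b) :
    ∃ H : L ⊗ Δ[1] ⟶ E, (∀ v, endpoint v L ≫ H = a v) ∧ i ▷ Δ[1] ≫ H = h ∧ H ≫ p = b := by
  have := hp _ (cylinderAnodyne_boundaryPushoutProduct hi)
  let t : pushout (i ▷ (SSet.boundary.{u} 1 : SSet.{u}))
      (K ◁ (SSet.boundary.{u} 1).ι) ⟶ E :=
    pushout.desc (boundaryDesc a) h (by
      refine boundaryEndpoint_hom_ext (fun v ↦ ?_)
      rw [reassoc_of% boundaryEndpoint_naturality, boundaryEndpoint_desc,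
        reassoc_of% boundaryEndpoint_comp, h₁])
  have sq : CommSq t (boundaryPushoutProduct i) p b := ⟨by
    apply pushout.hom_ext
    · rw [reassoc_of% inl_boundaryPushoutProduct, pushout.inl_desc_assoc]
      refine boundaryEndpoint_hom_ext (fun v ↦ ?_)
      rw [reassoc_of% boundaryEndpoint_desc, h₂, reassoc_of% boundaryEndpoint_comp]
    · rw [reassoc_of% inr_boundaryPushoutProduct, pushout.inr_desc_assoc, h₃]⟩
  refine ⟨sq.lift, fun v ↦ ?_, ?_, sq.fac_right⟩
  · have := pushout.inl _ _ ≫= sq.fac_left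
    rw [pushout.inl_desc, reassoc_of% inl_boundaryPushoutProduct] at this
    rw [← boundaryEndpoint_comp, Category.assoc, this, boundaryEndpoint_desc]
  · have := pushout.inr _ _ ≫= sq.fac_left
    rwa [pushout.inr_desc, reassoc_of% inr_boundaryPushoutProduct] at this

lemma cylinderAnodyne_endpoint (e : Fin 2) (X : SSet.{u}) :
    cylinderAnodyne e (endpoint e X) := by
  intro E B p hp
  rw [← cylinderFibrations_eq] at hp
  refine ⟨fun {a b} sq ↦ ?_⟩
  have hext {Y : SSet.{u}} (f g : ((⊥ : X.Subcomplex) : SSet.{u}) ⊗ Δ[1] ⟶ Y) : f = g := by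
    apply NatTrans.ext
    funext n
    ext ⟨⟨x, hx⟩, t⟩
    exact hx.elim
  -- The endpoint inclusion is the pushout-product of ∅ → X with the vertex, so the homotopy
  -- prescribed on the smaller object is vacuous.
  obtain ⟨H, h₁, -, h₂⟩ := exists_lift_of_endpoint hp (⊥ : X.Subcomplex).ι a
    (fst _ _ ≫ SSet.Subcomplex.isInitialBot.to E) b
    (SSet.Subcomplex.isInitialBot.hom_ext _ _) sq.w (hext _ _)
  exact ⟨⟨⟨H, h₁, h₂⟩⟩⟩

/-! ### Homotopy over a base as an equivalence relation. -/

section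

variable {A : SSet.{u}} {X W : Over A}

/-- A homotopy over `A` from `f` to `g`, where `g` sits at the endpoint `e`. -/
def EndpointHomotopic (e : Fin 2) (f g : X ⟶ W) : Prop :=
  ∃ h : X.left ⊗ Δ[1] ⟶ W.left,
    h ≫ W.hom = fst X.left Δ[1] ≫ X.hom ∧ endpoint e.rev X.left ≫ h = f.left ∧
      endpoint e X.left ≫ h = g.left

lemma endpointHomotopic_zero (f g : X ⟶ W) :
    EndpointHomotopic 0 f g ↔ SliceHomotopic g f :=
  exists_congr (fun _ ↦ and_congr Iff.rfl and_comm)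

lemma EndpointHomotopic.refl (e : Fin 2) (f : X ⟶ W) : EndpointHomotopic e f f :=
  ⟨fst _ _ ≫ f.left, by simp, by rw [reassoc_of% endpoint_fst], by rw [reassoc_of% endpoint_fst]⟩

/-- Two homotopies ending at `k`, together with the constant homotopy at `k`, form an open box. Its
filler exists because the endpoint `e` is anodyne, and its side at `e.rev` is the desired homotopy.
-/
lemma EndpointHomotopic.sliceHomotopic {e : Fin 2} (hW : cylinderFibrations e W.hom)
    {f g k : X ⟶ W} (h₁ : EndpointHomotopic e f k) (h₂ : EndpointHomotopic e g k) :
    SliceHomotopic f g := by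
  obtain ⟨a₀, h₀w, h₀, h₀'⟩ := h₁
  obtain ⟨a₁, h₁w, h₁, h₁'⟩ := h₂
  obtain ⟨H, hH, -, hw⟩ := exists_lift_of_boundary hW (endpoint e X.left)
    (cylinderAnodyne_endpoint e _) ![a₀, a₁] (fst _ _ ≫ k.left)
    (fst _ _ ≫ fst _ _ ≫ X.hom) (fun v ↦ by
      fin_cases v
      · rw [reassoc_of% endpoint_fst]; exact h₀'.symm
      · rw [reassoc_of% endpoint_fst]; exact h₁'.symm) (fun v ↦ by
      fin_cases v
      · rw [reassoc_of% endpoint_fst]; exact h₀w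
      · rw [reassoc_of% endpoint_fst]; exact h₁w) (by
      rw [whiskerRight_fst_assoc, reassoc_of% endpoint_fst, Category.assoc, Over.w])
  refine ⟨endpoint e.rev X.left ▷ Δ[1] ≫ H, ?_, ?_, ?_⟩
  · rw [Category.assoc, hw, whiskerRight_fst_assoc, reassoc_of% endpoint_fst]
  · rw [← endpoint_zero, reassoc_of% endpoint_naturality, hH]
    exact h₀
  · rw [← endpoint_one, reassoc_of% endpoint_naturality, hH]
    exact h₁

lemma sliceHomotopic_equivalence {e : Fin 2} (hW : cylinderFibrations e W.hom) :
    Equivalence (SliceHomotopic (X := X) (W := W)) := by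
  fin_cases e
  · have key {f g k : X ⟶ W} (h₁ : SliceHomotopic k f) (h₂ : SliceHomotopic k g) :
        SliceHomotopic f g :=
      EndpointHomotopic.sliceHomotopic hW ((endpointHomotopic_zero _ _).2 h₁)
        ((endpointHomotopic_zero _ _).2 h₂)
    -- `EndpointHomotopic 1` unfolds to `SliceHomotopic`, so the value 1 is right here although `e =
    -- 0`.
    have refl (f : X ⟶ W) : SliceHomotopic f f := EndpointHomotopic.refl 1 f
    have symm {f g : X ⟶ W} (h : SliceHomotopic f g) : SliceHomotopic g f := key h (refl f)
    exact ⟨refl, symm, fun h₁ h₂ ↦ key (symm h₁) h₂⟩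
  · have key {f g k : X ⟶ W} (h₁ : SliceHomotopic f k) (h₂ : SliceHomotopic g k) :
        SliceHomotopic f g :=
      EndpointHomotopic.sliceHomotopic (e := 1) hW h₁ h₂
    have refl (f : X ⟶ W) : SliceHomotopic f f := EndpointHomotopic.refl 1 f
    have symm {f g : X ⟶ W} (h : SliceHomotopic f g) : SliceHomotopic g f := key (refl g) h
    exact ⟨refl, symm, fun h₁ h₂ ↦ key h₁ (symm h₂)⟩

lemma sliceHomotopic_of_mk_eq {e : Fin 2} (hW : cylinderFibrations e W.hom) {f g : X ⟶ W}
    (h : (Quot.mk SliceHomotopic f : SliceHomotopyClasses X W) = Quot.mk _ g) :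
    SliceHomotopic f g :=
  (sliceHomotopic_equivalence hW).eqvGen_iff.1 (Quot.eqvGen_exact h)

lemma SliceHomotopic.endpointHomotopic {e : Fin 2} (hW : cylinderFibrations e W.hom)
    {f g : X ⟶ W} (h : SliceHomotopic f g) : EndpointHomotopic e f g := by
  have := (sliceHomotopic_equivalence hW).symm h
  fin_cases e
  · exact (endpointHomotopic_zero _ _).2 this
  · exact h

end

/-! ### Maps inducing bijections on homotopy classes. -/

section

variable {A : SSet.{u}}

/-- A trivial fibration has the right lifting property with respect to monomorphisms. -/
abbrev trivialFibrations : MorphismProperty SSet.{u} :=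
  (MorphismProperty.monomorphisms SSet.{u}).rlp

/-- Surjectivity extends maps along f; injectivity extends homotopies with prescribed ends, using
that the pushout-product of f with ∂Δ¹ is anodyne. -/
lemma isSliceEquivalence_of_cylinderAnodyne {e : Fin 2} {X Y : Over A} (f : X ⟶ Y)
    (hf : cylinderAnodyne e f.left) : IsSliceEquivalence e f := by
  intro W hW
  constructor
  · rintro ⟨g⟩ ⟨g'⟩ h
    obtain ⟨H, hw, h₀, h₁⟩ := sliceHomotopic_of_mk_eq hW h
    obtain ⟨G, hG, -, hGw⟩ := exists_lift_of_boundary hW f.left hf ![g.left, g'.left] H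
      (fst _ _ ≫ Y.hom) (fun v ↦ by
        fin_cases v
        · exact h₀
        · exact h₁) (fun v ↦ by
        fin_cases v
        · rw [reassoc_of% endpoint_fst]; exact Over.w g
        · rw [reassoc_of% endpoint_fst]; exact Over.w g') (by
        rw [hw, whiskerRight_fst_assoc, Over.w])
    exact Quot.sound ⟨G, hGw, hG 0, hG 1⟩
  · rintro ⟨g⟩
    have sq : CommSq g.left f.left W.hom Y.hom := ⟨by simp⟩
    have := hW _ hf
    refine ⟨Quot.mk _ (Over.homMk sq.lift sq.fac_right), ?_⟩
    refine congr_arg (Quot.mk _) ?_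
    ext : 1
    exact sq.fac_left

lemma trivialFibrations_exists_section {X Y : SSet.{u}} {q : X ⟶ Y} (hq : trivialFibrations q) :
    ∃ s : Y ⟶ X, s ≫ q = 𝟙 Y := by
  have := hq (⊥ : Y.Subcomplex).ι (MorphismProperty.monomorphisms.infer_property _)
  have sq : CommSq (SSet.Subcomplex.isInitialBot.to X) (⊥ : Y.Subcomplex).ι q (𝟙 Y) :=
    ⟨SSet.Subcomplex.isInitialBot.hom_ext _ _⟩
  exact ⟨sq.lift, sq.fac_right⟩

instance mono_whiskerLeft_boundary_ι (K : SSet.{u}) : Mono (K ◁ (SSet.boundary.{u} 1).ι) where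
  right_cancellation f g h := by
    apply CartesianMonoidalCategory.hom_ext
    · simpa using h =≫ fst _ _
    · rw [← cancel_mono (SSet.boundary.{u} 1).ι]
      simpa using h =≫ snd _ _

lemma trivialFibrations_exists_homotopy {X Y K : SSet.{u}} {q : X ⟶ Y}
    (hq : trivialFibrations q) (f g : K ⟶ X) (h : f ≫ q = g ≫ q) :
    ∃ H : K ⊗ Δ[1] ⟶ X, H ≫ q = fst _ _ ≫ f ≫ q ∧ SSet.ι₀ ≫ H = f ∧ SSet.ι₁ ≫ H = g := by
  have := hq (K ◁ (SSet.boundary.{u} 1).ι) (MorphismProperty.monomorphisms.infer_property _)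
  have sq : CommSq (boundaryDesc ![f, g]) (K ◁ (SSet.boundary.{u} 1).ι) q
      (fst _ _ ≫ f ≫ q) := ⟨by
    refine boundaryEndpoint_hom_ext (fun v ↦ ?_)
    rw [reassoc_of% boundaryEndpoint_desc, reassoc_of% boundaryEndpoint_comp,
      reassoc_of% endpoint_fst]
    fin_cases v
    · rfl
    · exact h.symm⟩
  have key (v : Fin 2) : endpoint v K ≫ sq.lift = ![f, g] v := by
    rw [← boundaryEndpoint_comp, Category.assoc, sq.fac_left, boundaryEndpoint_desc]
  exact ⟨sq.lift, sq.fac_right, key 0, key 1⟩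

/-- A trivial fibration has a section and is a homotopy equivalence over the base: the composite of
f and the section is homotopic to the identity along its fibres. -/
lemma isSliceEquivalence_of_trivialFibrations {e : Fin 2} {X Y : Over A} (f : X ⟶ Y)
    (hf : trivialFibrations f.left) : IsSliceEquivalence e f := by
  obtain ⟨s, hs⟩ := trivialFibrations_exists_section hf
  let s' : Y ⟶ X := Over.homMk s (by rw [← Over.w f, reassoc_of% hs])
  have hs' : s' ≫ f = 𝟙 Y := by ext : 1; exact hs
  obtain ⟨H, hH, h₀, h₁⟩ := trivialFibrations_exists_homotopy hf (f.left ≫ s) (𝟙 _) (by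
    rw [Category.assoc, hs, Category.comp_id, Category.id_comp])
  intro W hW
  constructor
  · intro g g' h
    have := congr_arg (SliceHomotopyClasses.precomp s' W) h
    obtain ⟨g⟩ := g
    obtain ⟨g'⟩ := g'
    change (Quot.mk _ (s' ≫ f ≫ g) : SliceHomotopyClasses Y W) = Quot.mk _ (s' ≫ f ≫ g') at this
    rwa [reassoc_of% hs', reassoc_of% hs'] at this
  · rintro ⟨g⟩
    refine ⟨Quot.mk _ (s' ≫ g), Quot.sound ⟨H ≫ g.left, ?_, ?_, ?_⟩⟩
    · rw [Category.assoc, Over.w, ← Over.w f, reassoc_of% hH, reassoc_of% hs]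
    · rw [reassoc_of% h₀]
      simp [s']
    · rw [reassoc_of% h₁]

lemma isSliceEquivalence_comp_iff {e : Fin 2} {X Y Z : Over A} (f : X ⟶ Y) (g : Y ⟶ Z)
    (hf : IsSliceEquivalence e f) : IsSliceEquivalence e (f ≫ g) ↔ IsSliceEquivalence e g := by
  refine forall₂_congr (fun W hW ↦ ?_)
  have : SliceHomotopyClasses.precomp (f ≫ g) W =
      SliceHomotopyClasses.precomp f W ∘ SliceHomotopyClasses.precomp g W := by
    funext x
    induction x using Quot.ind
    exact congr_arg (Quot.mk _) (Category.assoc _ _ _)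
  rw [this]
  exact (hf W hW).of_comp_iff' _

end

/-! ### Final maps, and final fibrations. -/

/-- Right-or-left finality: final maps for `e = 1` and initial maps for `e = 0`. -/
def IsEndpointFinal (e : Fin 2) {X Y : SSet.{u}} (f : X ⟶ Y) : Prop :=
  ∀ (A : SSet.{u}) (p : Y ⟶ A),
    IsSliceEquivalence e (Over.homMk f : Over.mk (f ≫ p) ⟶ Over.mk p)

lemma IsEndpointFinal.comp_iff {e : Fin 2} {X Y Z : SSet.{u}} {f : X ⟶ Y} (g : Y ⟶ Z)
    (hf : IsEndpointFinal e f) : IsEndpointFinal e (f ≫ g) ↔ IsEndpointFinal e g := by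
  refine forall₂_congr (fun A p ↦ ?_)
  rw [← isSliceEquivalence_comp_iff _ (Over.homMk g : Over.mk (g ≫ p) ⟶ Over.mk p)
    (hf A (g ≫ p))]
  -- The structure maps `f ≫ g ≫ p` and `(f ≫ g) ≫ p` give different objects over `A`; generalizing
  -- them allows substitution.
  have {P P' : X ⟶ A} (h : P = P') (w : f ≫ g ≫ p = P) (w' : f ≫ g ≫ p = P') :
      IsSliceEquivalence e (Over.homMk (f ≫ g) (by simpa using w) : Over.mk P ⟶ Over.mk p) ↔
      IsSliceEquivalence e (Over.homMk (f ≫ g) (by simpa using w') : Over.mk P' ⟶ Over.mk p) := by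
    subst h
    rfl
  exact this (Category.assoc f g p) (Category.assoc f g p).symm rfl

lemma IsEndpointFinal.of_cylinderAnodyne {e : Fin 2} {X Y : SSet.{u}} {f : X ⟶ Y}
    (hf : cylinderAnodyne e f) : IsEndpointFinal e f :=
  fun _ _ ↦ isSliceEquivalence_of_cylinderAnodyne _ hf

lemma IsEndpointFinal.of_trivialFibrations {e : Fin 2} {X Y : SSet.{u}} {f : X ⟶ Y}
    (hf : trivialFibrations f) : IsEndpointFinal e f :=
  fun _ _ ↦ isSliceEquivalence_of_trivialFibrations _ hf

/-- Finality over Y is tested against `q` itself: the class of the identity of X comes from a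
section s, with `q ≫ s` homotopic to the identity over Y. -/
lemma IsEndpointFinal.trivialFibrations {e : Fin 2} {X Y : SSet.{u}} {q : X ⟶ Y}
    (hq : IsEndpointFinal e q) (hq' : cylinderFibrations e q) : trivialFibrations q := by
  obtain ⟨⟨s⟩, hs⟩ := (hq Y (𝟙 Y) (Over.mk q) hq').2
    (Quot.mk _ (Over.homMk (𝟙 X) (by simp)))
  obtain ⟨h, hw, h₀, h₁⟩ := (sliceHomotopic_of_mk_eq (W := Over.mk q) hq' hs.symm).endpointHomotopic
    (e := e) hq'
  have hsq : s.left ≫ q = 𝟙 Y := Over.w s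
  replace hw : h ≫ q = fst X Δ[1] ≫ q := by simpa using hw
  replace h₀ : endpoint e.rev X ≫ h = 𝟙 X := h₀
  replace h₁ : endpoint e X ≫ h = q ≫ s.left := h₁
  intro K L i hi
  have : Mono i := hi
  refine ⟨fun {k b} sq ↦ ?_⟩
  -- The section solves the lifting problem up to the homotopy `h`. Transporting that solution from
  -- `e` to `e.rev` makes it strict on K.
  obtain ⟨H, -, hH, hHw⟩ := exists_lift_of_endpoint hq' i (b ≫ s.left) (k ▷ Δ[1] ≫ h)
    (fst _ _ ≫ b) (by rw [reassoc_of% endpoint_naturality, h₁, sq.w_assoc])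
    (by rw [Category.assoc, hsq, Category.comp_id, reassoc_of% endpoint_fst])
    (by rw [Category.assoc, hw, whiskerRight_fst_assoc, whiskerRight_fst_assoc, sq.w])
  refine ⟨⟨⟨endpoint e.rev L ≫ H, ?_, ?_⟩⟩⟩
  · rw [← reassoc_of% endpoint_naturality, hH, reassoc_of% endpoint_naturality, h₀,
      Category.comp_id]
  · rw [Category.assoc, hHw, reassoc_of% endpoint_fst]

/-! ### Factorization by the small object argument. -/

/-- A small set of generators for the cylinder anodyne extensions. -/
def cylinderGenerators (e : Fin 2) : MorphismProperty SSet.{u} :=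
  .ofHoms (fun n : ℕ ↦ ((SSet.boundary.{u} n).unionProd (vertexSubcomplex e)).ι)

lemma cylinderGenerators_rlp (e : Fin 2) :
    (cylinderGenerators.{u} e).rlp = cylinderFibrations e := by
  ext E B p
  rw [cylinderFibrations_iff]
  refine ⟨fun hp L A ↦ hasLiftingProperty_unionProd_of_boundary _ _ (fun n ↦ hp _ ⟨n⟩) A, ?_⟩
  rintro hp _ _ _ ⟨n⟩
  exact hp _

section

attribute [local instance] Cardinal.fact_isRegular_aleph0 Cardinal.orderBotAleph0OrdToType

instance (e : Fin 2) : MorphismProperty.IsSmall.{u} (cylinderGenerators.{u} e) :=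
  MorphismProperty.isSmall_ofHoms ..

instance (e : Fin 2) : MorphismProperty.IsCardinalForSmallObjectArgument
    (cylinderGenerators.{u} e) Cardinal.aleph0.{u} where
  preservesColimit {A B X Y} i hi f hf := by
    have : IsFinitelyPresentable.{u} A := by
      obtain ⟨n⟩ := hi
      infer_instance
    infer_instance

instance (e : Fin 2) : MorphismProperty.HasSmallObjectArgument.{u} (cylinderGenerators.{u} e) :=
  ⟨.aleph0, inferInstance, inferInstance, inferInstance⟩

end

lemma exists_factorization (e : Fin 2) {X Y : SSet.{u}} (f : X ⟶ Y) :
    ∃ (Z : SSet.{u}) (j : X ⟶ Z) (q : Z ⟶ Y), cylinderAnodyne e j ∧ cylinderFibrations e q ∧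
      j ≫ q = f := by
  rw [cylinderAnodyne, ← cylinderFibrations_eq, ← cylinderGenerators_rlp]
  let h := MorphismProperty.factorizationData (cylinderGenerators.{u} e).rlp.llp
    (cylinderGenerators.{u} e).rlp f
  exact ⟨h.Z, h.i, h.p, h.hi, h.hp, h.fac⟩

/-! ### Contraction of the cylinder and the basic case of stability. -/

/-- The maximum on `Δ[1]` if `e = 1`, and the minimum if `e = 0`. -/
def connectionFun (e x y : Fin 2) : Fin 2 := if e = 0 then min x y else max x y

lemma connectionFun_monotone {e x y x' y' : Fin 2} (hx : x ≤ x') (hy : y ≤ y') :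
    connectionFun e x y ≤ connectionFun e x' y' := by
  unfold connectionFun
  split_ifs
  · exact min_le_min hx hy
  · exact max_le_max hx hy

lemma connectionFun_left (e x : Fin 2) : connectionFun e e x = e := by
  revert e x; decide

lemma connectionFun_right (e x : Fin 2) : connectionFun e x e = e := by
  revert e x; decide

lemma connectionFun_rev (e x : Fin 2) : connectionFun e x e.rev = x := by
  revert e x; decide

/-- The connection `Δ[1] × Δ[1] ⟶ Δ[1]` contracting `Δ[1]` onto the vertex `e`. -/
noncomputable def connection (e : Fin 2) : (Δ[1] : SSet.{u}) ⊗ Δ[1] ⟶ Δ[1] where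
  app _ := ↾fun x ↦ SSet.stdSimplex.objEquiv.symm (SimplexCategory.Hom.mk
    ⟨fun i ↦ connectionFun e ((SSet.stdSimplex.objEquiv x.1).toOrderHom i)
        ((SSet.stdSimplex.objEquiv x.2).toOrderHom i),
      fun _ _ h ↦ connectionFun_monotone ((SSet.stdSimplex.objEquiv x.1).toOrderHom.monotone h)
        ((SSet.stdSimplex.objEquiv x.2).toOrderHom.monotone h)⟩)
  naturality _ _ _ := rfl

lemma connection_mem_left {e : Fin 2} {n : SimplexCategoryᵒᵖ} {s : (Δ[1] : SSet.{u}).obj n}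
    (hs : s ∈ (vertexSubcomplex.{u} e).obj n) (t : (Δ[1] : SSet.{u}).obj n) :
    (connection e).app n (s, t) ∈ (vertexSubcomplex.{u} e).obj n := by
  obtain ⟨n⟩ := n
  induction n using SimplexCategory.rec with | _ n
  rw [SSet.stdSimplex.mem_face_iff] at hs ⊢
  simp only [Finset.mem_singleton] at hs ⊢
  intro i
  refine Eq.trans (congr_arg₂ (connectionFun e) (hs i) rfl) (connectionFun_left e _)

lemma connection_mem_right {e : Fin 2} {n : SimplexCategoryᵒᵖ} (s : (Δ[1] : SSet.{u}).obj n) :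
    (connection e).app n (s, constSimplex e n) ∈ (vertexSubcomplex.{u} e).obj n := by
  obtain ⟨n⟩ := n
  induction n using SimplexCategory.rec with | _ n
  rw [SSet.stdSimplex.mem_face_iff]
  simp only [Finset.mem_singleton]
  intro i
  exact connectionFun_right e _

lemma connection_rev {e : Fin 2} {n : SimplexCategoryᵒᵖ} (s : (Δ[1] : SSet.{u}).obj n) :
    (connection e).app n (s, constSimplex e.rev n) = s := by
  obtain ⟨n⟩ := n
  induction n using SimplexCategory.rec with | _ n
  ext i : 1
  exact connectionFun_rev e _

/-- The deformation of `L ⊗ Δ[1]` onto its endpoint `e`. -/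
noncomputable def contraction (e : Fin 2) (L : SSet.{u}) :
    (L ⊗ Δ[1]) ⊗ Δ[1] ⟶ L ⊗ Δ[1] :=
  (α_ _ _ _).hom ≫ L ◁ connection e

lemma endpoint_rev_contraction (e : Fin 2) (L : SSet.{u}) :
    endpoint e.rev (L ⊗ Δ[1]) ≫ contraction e L = 𝟙 _ := by
  apply NatTrans.ext
  funext n
  ext ⟨x, s⟩
  exact Prod.ext rfl (connection_rev s)

lemma contraction_mem {e : Fin 2} {L : SSet.{u}} (A : L.Subcomplex) {n : SimplexCategoryᵒᵖ}
    {x : (L ⊗ Δ[1]).obj n} (hx : x ∈ (A.unionProd (vertexSubcomplex e)).obj n)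
    (t : (Δ[1] : SSet.{u}).obj n) :
    (contraction e L).app n (x, t) ∈ (A.unionProd (vertexSubcomplex e)).obj n := by
  refine (SSet.Subcomplex.mem_unionProd_iff _ _ _).2 ?_
  obtain h | h := (SSet.Subcomplex.mem_unionProd_iff _ _ _).1 hx
  · exact Or.inl (connection_mem_left h t)
  · exact Or.inr h

lemma contraction_endpoint_mem {e : Fin 2} {L : SSet.{u}} (A : L.Subcomplex)
    {n : SimplexCategoryᵒᵖ} (x : (L ⊗ Δ[1]).obj n) :
    (endpoint e _ ≫ contraction e L).app n x ∈ (A.unionProd (vertexSubcomplex e)).obj n :=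
  (SSet.Subcomplex.mem_unionProd_iff _ _ _).2 (Or.inl (connection_mem_right _))

/-- The basic case of properness: pulling back along a fibration for the opposite endpoint
the inclusion `A × Δ[1] ∪ L × {e} ⟶ L × Δ[1]` gives an anodyne extension. -/
lemma cylinderAnodyne_of_isPullback_unionProd {e : Fin 2} {L : SSet.{u}} (A : L.Subcomplex)
    {E E' : SSet.{u}} {p : E ⟶ L ⊗ Δ[1]} (hp : cylinderFibrations e.rev p) {i : E' ⟶ E}
    {p' : E' ⟶ (A.unionProd (vertexSubcomplex e) : SSet.{u})}
    (sq : IsPullback i p' p (A.unionProd (vertexSubcomplex e)).ι) : cylinderAnodyne e i := by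
  rw [cylinderAnodyne_iff]
  intro Z W f hf
  refine ⟨fun {u w} sqf ↦ ?_⟩
  have : Mono i := MorphismProperty.of_isPullback (P := MorphismProperty.monomorphisms _) sq.flip
    (MorphismProperty.monomorphisms.infer_property _)
  -- As p is an `e.rev`-fibration, the contraction lifts to a homotopy `h` on E starting from the
  -- identity at `e.rev`.
  have hlift := cylinderAnodyne_endpoint e.rev E p (by rwa [← cylinderFibrations_eq])
  have sqh : CommSq (𝟙 E) (endpoint e.rev E) p (p ▷ Δ[1] ≫ contraction e L) := ⟨by
    rw [reassoc_of% endpoint_naturality, endpoint_rev_contraction, Category.id_comp,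
      Category.comp_id]⟩
  obtain ⟨h, h₀, hh⟩ : ∃ h, endpoint e.rev E ≫ h = 𝟙 E ∧ h ≫ p = p ▷ Δ[1] ≫ contraction e L :=
    ⟨sqh.lift, sqh.fac_left, sqh.fac_right⟩
  -- At time `e` the contraction lands in L × {e}, so `h` ends inside E'.
  obtain ⟨r, hr⟩ : ∃ r : E ⟶ E', r ≫ i = endpoint e E ≫ h := by
    refine ⟨sq.lift (endpoint e E ≫ h) (SSet.Subcomplex.lift (endpoint e E ≫ h ≫ p) ?_) ?_,
      sq.lift_fst _ _ _⟩
    · rw [hh, reassoc_of% endpoint_naturality]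
      rintro n _ ⟨x, rfl⟩
      exact contraction_endpoint_mem A _
    · exact Category.assoc _ _ _
  -- The contraction preserves A × Δ¹ ∪ L × {e}, so `h` restricts to E'.
  obtain ⟨k, hk⟩ : ∃ k : E' ⊗ Δ[1] ⟶ E', k ≫ i = i ▷ Δ[1] ≫ h := by
    refine ⟨sq.lift (i ▷ Δ[1] ≫ h) (SSet.Subcomplex.lift (i ▷ Δ[1] ≫ h ≫ p) ?_) ?_,
      sq.lift_fst _ _ _⟩
    · rw [hh, ← MonoidalCategory.comp_whiskerRight_assoc, sq.w]
      rintro n _ ⟨⟨x, t⟩, rfl⟩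
      exact contraction_mem A (p'.app n x).2 t
    · exact Category.assoc _ _ _
  have hk₁ : endpoint e E' ≫ k = i ≫ r := by
    rw [← cancel_mono i, Category.assoc, hk, Category.assoc, hr, reassoc_of% endpoint_naturality]
  have hk₀ : endpoint e.rev E' ≫ k = 𝟙 E' := by
    rw [← cancel_mono i, Category.assoc, hk, reassoc_of% endpoint_naturality, h₀, Category.comp_id,
      Category.id_comp]
  -- At time `e` the map `r ≫ u` is a lift of the deformed problem. The `e`-fibration f carries it
  -- back to `e.rev`, where `h` and `k` are identities and the original problem is recovered.
  obtain ⟨H, -, hH, hHw⟩ := exists_lift_of_endpoint hf i (r ≫ u) (k ≫ u) (h ≫ w)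
    (by rw [reassoc_of% hk₁]) (by rw [Category.assoc, sqf.w, reassoc_of% hr])
    (by rw [Category.assoc, sqf.w, reassoc_of% hk])
  refine ⟨⟨⟨endpoint e.rev E ≫ H, ?_, ?_⟩⟩⟩
  · rw [← reassoc_of% endpoint_naturality, hH, reassoc_of% hk₀]
  · rw [Category.assoc, hHw, reassoc_of% h₀]

end

/-! ### The dependent product along a map, built simplexwise. -/

lemma exists_of_isPullback {T E K B : SSet.{u}} {t₁ : T ⟶ E} {t₂ : T ⟶ K} {p : E ⟶ B} {c : K ⟶ B}
    (sq : IsPullback t₁ t₂ p c) {n : SimplexCategoryᵒᵖ} (x : E.obj n) (k : K.obj n)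
    (h : p.app n x = c.app n k) : ∃ τ : T.obj n, t₁.app n τ = x ∧ t₂.app n τ = k :=
  Types.exists_of_isPullback (sq.map ((evaluation _ _).obj n)) x k h

/-- The simplex of a pullback given by a pair of compatible simplices. -/
noncomputable def pullbackPair {T E K B : SSet.{u}} {t₁ : T ⟶ E} {t₂ : T ⟶ K} {p : E ⟶ B}
    {c : K ⟶ B} (sq : IsPullback t₁ t₂ p c) {n : SimplexCategoryᵒᵖ} (x : E.obj n) (k : K.obj n)
    (h : p.app n x = c.app n k) : T.obj n :=
  (exists_of_isPullback sq x k h).choose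

lemma pullbackPair_fst {T E K B : SSet.{u}} {t₁ : T ⟶ E} {t₂ : T ⟶ K} {p : E ⟶ B}
    {c : K ⟶ B} (sq : IsPullback t₁ t₂ p c) {n : SimplexCategoryᵒᵖ} (x : E.obj n) (k : K.obj n)
    (h : p.app n x = c.app n k) : t₁.app n (pullbackPair sq x k h) = x :=
  (exists_of_isPullback sq x k h).choose_spec.1

lemma pullbackPair_snd {T E K B : SSet.{u}} {t₁ : T ⟶ E} {t₂ : T ⟶ K} {p : E ⟶ B}
    {c : K ⟶ B} (sq : IsPullback t₁ t₂ p c) {n : SimplexCategoryᵒᵖ} (x : E.obj n) (k : K.obj n)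
    (h : p.app n x = c.app n k) : t₂.app n (pullbackPair sq x k h) = k :=
  (exists_of_isPullback sq x k h).choose_spec.2

lemma ext_of_isPullback {T E K B : SSet.{u}} {t₁ : T ⟶ E} {t₂ : T ⟶ K} {p : E ⟶ B} {c : K ⟶ B}
    (sq : IsPullback t₁ t₂ p c) {n : SimplexCategoryᵒᵖ} {τ τ' : T.obj n}
    (h₁ : t₁.app n τ = t₁.app n τ') (h₂ : t₂.app n τ = t₂.app n τ') : τ = τ' :=
  Types.ext_of_isPullback (sq.map ((evaluation _ _).obj n)) h₁ h₂

section

variable {E B Z W : SSet.{u}} (p : E ⟶ B) (f : Z ⟶ W) (w : E ⟶ W)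

/-- The simplices of the dependent product along `p : E ⟶ B` of the pullback of `f` along `w`:
a simplex of `B` together with a lift to `Z` of the restriction of `w` to the fibre over it. -/
structure PiSimplex (n : SimplexCategoryᵒᵖ) : Type u where
  base : B.obj n
  sec ⦃m : SimplexCategoryᵒᵖ⦄ (α : n ⟶ m) (x : E.obj m) (hx : p.app m x = B.map α base) : Z.obj m
  comp_sec ⦃m : SimplexCategoryᵒᵖ⦄ (α : n ⟶ m) (x : E.obj m) (hx : p.app m x = B.map α base) :
    f.app m (sec α x hx) = w.app m x
  map_sec ⦃m m' : SimplexCategoryᵒᵖ⦄ (α : n ⟶ m) (β : m ⟶ m') (x : E.obj m)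
    (hx : p.app m x = B.map α base) (hx' : p.app m' (E.map β x) = B.map (α ≫ β) base) :
    Z.map β (sec α x hx) = sec (α ≫ β) (E.map β x) hx'

variable {p f w}

namespace PiSimplex

lemma ext_sec {n : SimplexCategoryᵒᵖ} {a b : PiSimplex p f w n} (h : a.base = b.base)
    (h' : ∀ ⦃m : SimplexCategoryᵒᵖ⦄ (α : n ⟶ m) (x : E.obj m) (hx : p.app m x = B.map α a.base),
      a.sec α x hx = b.sec α x (by rw [← h]; exact hx)) : a = b := by
  obtain ⟨a, s, _, _⟩ := a
  obtain ⟨b, t, _, _⟩ := b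
  obtain rfl : a = b := h
  obtain rfl : s = t := by
    funext m α x hx
    exact h' α x hx
  rfl

lemma sec_congr {n : SimplexCategoryᵒᵖ} {a b : PiSimplex p f w n} (h : a = b)
    {m : SimplexCategoryᵒᵖ} {α β : n ⟶ m} (hα : α = β) {x y : E.obj m} (hxy : x = y)
    (hx : p.app m x = B.map α a.base) (hy : p.app m y = B.map β b.base) :
    a.sec α x hx = b.sec β y hy := by
  subst h hα hxy
  rfl

/-- The restriction of a simplex of the dependent product. -/
def map {n m : SimplexCategoryᵒᵖ} (γ : n ⟶ m) (a : PiSimplex p f w n) : PiSimplex p f w m where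
  base := B.map γ a.base
  sec _ α x hx := a.sec (γ ≫ α) x (by rw [hx, Functor.map_comp_apply])
  comp_sec _ α x hx := a.comp_sec _ _ _
  map_sec _ _ α β x hx hx' := by
    rw [a.map_sec (γ ≫ α) β x _ (by rw [hx', ← Functor.map_comp_apply, Category.assoc])]
    exact sec_congr rfl (Category.assoc _ _ _) rfl _ _

end PiSimplex

variable (p f w)

/-- The dependent product along `p : E ⟶ B` of the pullback of `f` along `w`. -/
def PiObj : SSet.{u} where
  obj n := PiSimplex p f w n
  map γ := ↾fun a ↦ a.map γ
  map_id n := by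
    ext a
    refine PiSimplex.ext_sec (Functor.map_id_apply B n _) (fun m α x hx ↦ ?_)
    exact PiSimplex.sec_congr rfl (Category.id_comp _) rfl _ _
  map_comp γ γ' := by
    ext a
    refine PiSimplex.ext_sec (Functor.map_comp_apply B γ γ' _) (fun m α x hx ↦ ?_)
    exact PiSimplex.sec_congr rfl (Category.assoc _ _ _) rfl _ _

/-- The projection from the dependent product to the base. -/
def PiObj.π : PiObj p f w ⟶ B where
  app _ := ↾fun a ↦ PiSimplex.base a
  naturality _ _ _ := rfl

variable {p f w} {K T : SSet.{u}} {t₁ : T ⟶ E} {t₂ : T ⟶ K}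

/-- The map to `Z` corresponding to a map to the dependent product. -/
def PiObj.uncurry (g : K ⟶ PiObj p f w) (h : t₁ ≫ p = t₂ ≫ g ≫ PiObj.π p f w) : T ⟶ Z where
  app n := ↾fun τ ↦ PiSimplex.sec (g.app n (t₂.app n τ)) (𝟙 n) (t₁.app n τ) (by
    rw [Functor.map_id_apply]
    exact ConcreteCategory.congr_hom (NatTrans.congr_app h n) τ)
  naturality n m γ := by
    ext τ
    have h₁ : t₁.app m (T.map γ τ) = E.map γ (t₁.app n τ) := NatTrans.naturality_apply t₁ γ τ
    have h₂ : g.app m (t₂.app m (T.map γ τ)) = (g.app n (t₂.app n τ)).map γ := by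
      rw [NatTrans.naturality_apply t₂ γ τ]
      exact NatTrans.naturality_apply g γ _
    have h₃ : p.app n (t₁.app n τ) = B.map (𝟙 n) (PiSimplex.base (g.app n (t₂.app n τ))) := by
      rw [Functor.map_id_apply]
      exact ConcreteCategory.congr_hom (NatTrans.congr_app h n) τ
    have h₄ : p.app m (E.map γ (t₁.app n τ)) =
        B.map (𝟙 n ≫ γ) (PiSimplex.base (g.app n (t₂.app n τ))) := by
      rw [NatTrans.naturality_apply, h₃, ← Functor.map_comp_apply]
    refine Eq.trans ?_ (PiSimplex.map_sec (g.app n (t₂.app n τ)) (𝟙 n) γ (t₁.app n τ) h₃ h₄).symm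
    refine (PiSimplex.sec_congr h₂ rfl h₁ _ ?_).trans ?_
    · rw [Functor.map_id_apply, NatTrans.naturality_apply, h₃, Functor.map_id_apply]
      rfl
    · exact PiSimplex.sec_congr rfl ((Category.comp_id _).trans (Category.id_comp _).symm) rfl _ _

lemma PiObj.uncurry_comp (g : K ⟶ PiObj p f w) (h : t₁ ≫ p = t₂ ≫ g ≫ PiObj.π p f w) :
    PiObj.uncurry g h ≫ f = t₁ ≫ w := by
  apply NatTrans.ext
  funext n
  ext τ
  exact PiSimplex.comp_sec _ _ _ _

/-- The map to the dependent product corresponding to a map to `Z`. -/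
noncomputable def PiObj.curry {c : K ⟶ B} (sq : IsPullback t₁ t₂ p c) (s : T ⟶ Z)
    (hs : s ≫ f = t₁ ≫ w) : K ⟶ PiObj p f w where
  app n := ↾fun k ↦
    { base := c.app n k
      sec _ α x hx := s.app _ (pullbackPair sq x (K.map α k) (by
        rw [hx, ← NatTrans.naturality_apply]))
      comp_sec m α x hx := by
        refine (ConcreteCategory.congr_hom (NatTrans.congr_app hs m) _).trans
          (congr_arg (w.app m) (pullbackPair_fst sq _ _ _))
      map_sec m m' α β x hx hx' := by
        rw [← NatTrans.naturality_apply]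
        refine congr_arg _ (ext_of_isPullback sq ?_ ?_)
        · rw [NatTrans.naturality_apply, pullbackPair_fst, pullbackPair_fst]
        · rw [NatTrans.naturality_apply, pullbackPair_snd, pullbackPair_snd,
            ← Functor.map_comp_apply] }
  naturality n m γ := by
    ext k
    have hb : c.app m (K.map γ k) = B.map γ (c.app n k) := NatTrans.naturality_apply c γ k
    refine PiSimplex.ext_sec hb (fun m' α x hx ↦ ?_)
    refine congr_arg (s.app m') (ext_of_isPullback sq ?_ ?_)
    · rw [pullbackPair_fst, pullbackPair_fst]
    · refine (pullbackPair_snd sq _ _ _).trans (Eq.trans ?_ (pullbackPair_snd sq _ _ _).symm)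
      exact (Functor.map_comp_apply K γ α k).symm

lemma PiObj.curry_π {c : K ⟶ B} (sq : IsPullback t₁ t₂ p c) (s : T ⟶ Z)
    (hs : s ≫ f = t₁ ≫ w) : PiObj.curry sq s hs ≫ PiObj.π p f w = c := rfl

lemma PiObj.curry_sec {c : K ⟶ B} (sq : IsPullback t₁ t₂ p c) (s : T ⟶ Z)
    (hs : s ≫ f = t₁ ≫ w) {n m : SimplexCategoryᵒᵖ} (k : K.obj n) (α : n ⟶ m) (x : E.obj m)
    (hx : p.app m x = B.map α (c.app n k)) (τ : T.obj m) (h₁ : t₁.app m τ = x)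
    (h₂ : t₂.app m τ = K.map α k) :
    PiSimplex.sec ((PiObj.curry sq s hs).app n k) α x hx = s.app m τ := by
  refine congr_arg (s.app m) (ext_of_isPullback sq ?_ ?_)
  · exact (pullbackPair_fst sq _ _ _).trans h₁.symm
  · exact (pullbackPair_snd sq _ _ _).trans h₂.symm

/-- If the pullback of a section problem along `p` is solvable, so is the corresponding
lifting problem against the projection of the dependent product. -/
lemma PiObj.hasLift {S : SSet.{u}} {i : S ⟶ K} {g : S ⟶ PiObj p f w} {c : K ⟶ B}
    (sqg : CommSq g i (PiObj.π p f w) c) (sq : IsPullback t₁ t₂ p c) {T' : SSet.{u}}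
    {i' : T' ⟶ T} {t' : T' ⟶ S} (sq' : IsPullback i' t' t₂ i) (hi : HasLiftingProperty i' f) :
    sqg.HasLift := by
  have hg : (i' ≫ t₁) ≫ p = t' ≫ g ≫ PiObj.π p f w := by
    rw [sqg.w, Category.assoc, sq.w, reassoc_of% sq'.w]
  -- The transposed problem: S and K are replaced by their pullbacks T' and T along p, and the
  -- projection by f.
  have sqf : CommSq (PiObj.uncurry g hg) i' f (t₁ ≫ w) := ⟨by
    rw [PiObj.uncurry_comp, Category.assoc]⟩
  refine ⟨⟨⟨PiObj.curry sq sqf.lift sqf.fac_right, ?_, PiObj.curry_π _ _ _⟩⟩⟩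
  apply NatTrans.ext
  funext n
  ext k
  have hb : c.app n (i.app n k) = PiSimplex.base (g.app n k) :=
    (ConcreteCategory.congr_hom (NatTrans.congr_app sqg.w n) k).symm
  refine PiSimplex.ext_sec hb (fun m α x hx ↦ ?_)
  obtain ⟨τ, rfl, hτ₂⟩ := exists_of_isPullback sq x (K.map α (i.app n k))
    (Eq.trans hx (NatTrans.naturality_apply c α _).symm)
  obtain ⟨τ', rfl, hτ'⟩ := exists_of_isPullback sq' τ (S.map α k)
    (hτ₂.trans (NatTrans.naturality_apply i α k).symm)
  refine (PiObj.curry_sec sq _ sqf.fac_right _ α _ _ _ rfl hτ₂).trans ?_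
  refine (ConcreteCategory.congr_hom (NatTrans.congr_app sqf.fac_left m) τ').trans ?_
  have h₁ : g.app m (t'.app m τ') = (g.app n k).map α := by
    rw [hτ']
    exact NatTrans.naturality_apply g α k
  exact (PiSimplex.sec_congr h₁ rfl rfl _ (by
      rw [Functor.map_id_apply]
      exact Eq.trans hx (congr_arg (B.map α) hb))).trans
    (PiSimplex.sec_congr rfl (Category.comp_id _) rfl _ _)

end

/-! ### Stability of anodyne extensions and of final maps under pullback. -/

lemma cylinderFibrations_of_isPullback {e : Fin 2} {E' E B' B : SSet.{u}} {f : E' ⟶ E}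
    {p' : E' ⟶ B'} {p : E ⟶ B} {g : B' ⟶ B} (sq : IsPullback f p' p g)
    (hp : cylinderFibrations e p) : cylinderFibrations e p' :=
  MorphismProperty.of_isPullback (P := (cylinderAnodyne e).rlp) sq hp

/-- Transposition turns lifting against A × Δ¹ ∪ L × {e} → L × Δ¹ into lifting f against the
pullback of that inclusion along p, which is anodyne by the basic case. -/
lemma cylinderFibrations_piObj_π {e : Fin 2} {E B Z W : SSet.{u}} {p : E ⟶ B} {f : Z ⟶ W}
    (hp : cylinderFibrations e.rev p) (hf : cylinderFibrations e f) (w : E ⟶ W) :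
    cylinderFibrations e (PiObj.π p f w) := by
  rw [cylinderFibrations_iff]
  intro L A
  refine ⟨fun {g c} sqg ↦ ?_⟩
  have sq := IsPullback.of_hasPullback p c
  have sq' := IsPullback.of_hasPullback (pullback.snd p c) (A.unionProd (vertexSubcomplex e)).ι
  exact PiObj.hasLift sqg sq sq' ((cylinderAnodyne_iff e _).1
    (cylinderAnodyne_of_isPullback_unionProd A (cylinderFibrations_of_isPullback sq hp) sq') _ hf)

/-- Anodyne extensions are stable under pullback along the fibrations of the opposite direction. -/
lemma cylinderAnodyne_of_isPullback {e : Fin 2} {A B E E' : SSet.{u}} {j : A ⟶ B}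
    (hj : cylinderAnodyne e j) {p : E ⟶ B} (hp : cylinderFibrations e.rev p) {i : E' ⟶ E}
    {q : E' ⟶ A} (sq : IsPullback i q p j) : cylinderAnodyne e i := by
  rw [cylinderAnodyne_iff]
  intro Z W f hf
  refine ⟨fun {s w} sqf ↦ ?_⟩
  -- The problem for `i` against f becomes the extension along `j` of a partial section of the
  -- dependent product over B.
  have sqg : CommSq (PiObj.curry sq s sqf.w) j (PiObj.π p f w) (𝟙 B) :=
    ⟨(PiObj.curry_π _ _ _).trans (Category.comp_id _).symm⟩
  have := (cylinderAnodyne_iff e j).1 hj _ (cylinderFibrations_piObj_π hp hf w)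
  have hG : 𝟙 E ≫ p = p ≫ sqg.lift ≫ PiObj.π p f w := by
    rw [sqg.fac_right, Category.id_comp, Category.comp_id]
  refine ⟨⟨⟨PiObj.uncurry sqg.lift hG, ?_, by rw [PiObj.uncurry_comp, Category.id_comp]⟩⟩⟩
  apply NatTrans.ext
  funext n
  ext y
  have h₁ : sqg.lift.app n (p.app n (i.app n y)) = (PiObj.curry sq s sqf.w).app n (q.app n y) :=
    (congr_arg _ (ConcreteCategory.congr_hom (NatTrans.congr_app sq.w n) y)).trans
      (ConcreteCategory.congr_hom (NatTrans.congr_app sqg.fac_left n) _)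
  have h₂ : p.app n (i.app n y) = B.map (𝟙 n) (j.app n (q.app n y)) := by
    rw [Functor.map_id_apply]
    exact ConcreteCategory.congr_hom (NatTrans.congr_app sq.w n) y
  exact (PiSimplex.sec_congr h₁ rfl rfl _ h₂).trans
    (PiObj.curry_sec sq s sqf.w _ (𝟙 n) _ h₂ y rfl (Functor.map_id_apply A n _).symm)

lemma IsEndpointFinal.of_isPullback {e : Fin 2} {A' B' A B : SSet.{u}} {w : A' ⟶ B'} {a : A' ⟶ A}
    {b : B' ⟶ B} {v : A ⟶ B} (sq : IsPullback w a b v) (hb : cylinderFibrations e.rev b)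
    (hv : IsEndpointFinal e v) : IsEndpointFinal e w := by
  obtain ⟨C, j, q, hj, hq, rfl⟩ := exists_factorization e v
  have hq' := ((IsEndpointFinal.comp_iff q (.of_cylinderAnodyne hj)).1 hv).trivialFibrations hq
  have sqC := IsPullback.of_hasPullback b q
  have sqj : IsPullback (sqC.lift w (a ≫ j) (by rw [sq.w, Category.assoc])) a
      (pullback.snd b q) j :=
    IsPullback.of_right (by simpa using sq) (by simp) sqC
  have hw := sqC.lift_fst w (a ≫ j) (by rw [sq.w, Category.assoc])
  rw [← hw, IsEndpointFinal.comp_iff _ (.of_cylinderAnodyne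
    (cylinderAnodyne_of_isPullback hj (cylinderFibrations_of_isPullback sqC hb) sqj))]
  exact .of_trivialFibrations (MorphismProperty.of_isPullback sqC.flip hq')

end SimplicialFinality

theorem mainTheorem9 :
    (∀ {X Y : SSet.{u}} (p : X ⟶ Y),
      SimplicialFinality.leftFibrations p → SimplicialFinality.IsProperMap p) ∧
    (∀ {X Y : SSet.{u}} (p : X ⟶ Y),
      SimplicialFinality.rightFibrations p → SimplicialFinality.IsSmoothMap p) := by
  refine ⟨fun p hp _ _ _ _ _ _ _ _ _ _ sq sq' hv ↦ ?_, fun p hp _ _ _ _ _ _ _ _ _ _ sq sq' hv ↦ ?_⟩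
  -- Finality concerns the endpoint 1, and left fibrations are fibrations for its reverse, 0.
  · exact SimplicialFinality.IsEndpointFinal.of_isPullback (e := 1) sq
      (SimplicialFinality.cylinderFibrations_of_isPullback sq'
        (SimplicialFinality.leftFibrations_le hp)) hv
  · exact SimplicialFinality.IsEndpointFinal.of_isPullback (e := 0) sq
      (SimplicialFinality.cylinderFibrations_of_isPullback sq'
        (SimplicialFinality.rightFibrations_le hp)) hv
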